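/- Fix a real number $\varepsilon>0$. Then there is an integer $N=N(\varepsilon)$ such that for every integer $n\ge N$ and every positive integer $b\le\left(\frac12-\varepsilon\right)n$, Maker has a winning strategy in the $(1:b)$ Maker–Breaker non-planarity game on $E(K_n)$. Here the board is the edge set $E(K_n)$ of the complete graph on $n$ vertices. Two players, Maker and Breaker, alternately claim previously unclaimed edges, with Maker moving first; Maker claims exactly $1$ edge and Breaker exactly $b$ edges per turn (a player facing fewer unclaimed edges than that claims all of them). The game ends when all edges have been claimed, and Maker wins if and only if the graph formed by his edges is non-planar, i.e. contains all the edges of some non-planar graph on the same $n$ vertices. A graph is planar if it can be drawn in the Euclidean plane with distinct vertices as distinct points and edges as simple continuous arcs joining their end-vertices, such that the interior of an edge contains no vertex and the interiors of distinct edges are disjoint. -/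

import Mathlib

/-! ### Biased Maker-Breaker games -/

/-- A legal turn of a player with bias `q`: when `M` and `B` are the sets already claimed by Maker
and Breaker, the player claims a set `C` of exactly `q` free elements of the board, or all the
remaining free elements if fewer than `q` are left. -/
def IsLegalClaim {α : Type*} [DecidableEq α] (board : Finset α) (q : ℕ) (M B C : Finset α) : Prop :=
  C ⊆ board \ (M ∪ B) ∧ C.card = min q (board \ (M ∪ B)).card

/-- `MakerWinsFrom board H m b M B`: in the biased `(m : b)` Maker-Breaker game on the hypergraph
`(board, H)`, Maker has a winning strategy from the position in which Maker has claimed `M`,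
Breaker has claimed `B`, and it is Maker's turn. A final position (no free element left) is won by
Maker if he has fully occupied a winning set `A ∈ H`; any other position is won by him if he has a
legal turn `C` such that he wins after every legal answer `D` of Breaker. -/
inductive MakerWinsFrom {α : Type*} [DecidableEq α] (board : Finset α) (H : Set (Finset α))
    (m b : ℕ) : Finset α → Finset α → Prop
  | final (M B : Finset α) (hfull : board \ (M ∪ B) = ∅) (hwin : ∃ A ∈ H, A ⊆ M) :
      MakerWinsFrom board H m b M B
  | turn (M B C : Finset α) (hfree : (board \ (M ∪ B)).Nonempty)
      (hC : IsLegalClaim board m M B C)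
      (hD : ∀ D, IsLegalClaim board b (M ∪ C) B D →
        MakerWinsFrom board H m b (M ∪ C) (B ∪ D)) :
      MakerWinsFrom board H m b M B

/-- Maker wins the biased `(m : b)` Maker-Breaker game on `(board, H)`, moving first. -/
def MakerWins {α : Type*} [DecidableEq α] (board : Finset α) (H : Set (Finset α))
    (m b : ℕ) : Prop :=
  MakerWinsFrom board H m b ∅ ∅

/-! ### Planar graphs -/

/-- A drawing of `G` in the Euclidean plane without crossings: distinct vertices are distinct
points, every edge is a simple arc joining its two end-vertices, the interior of an edge contains
no vertex, and the interiors of distinct edges are disjoint. -/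
structure PlaneDrawing {V : Type*} (G : SimpleGraph V) where
  point : V → EuclideanSpace ℝ (Fin 2)
  arc : G.edgeSet → C(unitInterval, EuclideanSpace ℝ (Fin 2))
  point_injective : Function.Injective point
  arc_injective : ∀ e, Function.Injective (arc e)
  arc_ends : ∀ e : G.edgeSet, s(arc e 0, arc e 1) = Sym2.map point (e : Sym2 V)
  arc_ne_point : ∀ e, ∀ t ∈ Set.Ioo (0 : unitInterval) 1, ∀ v, arc e t ≠ point v
  arc_ne_arc : ∀ e f, e ≠ f → ∀ s ∈ Set.Ioo (0 : unitInterval) 1,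
    ∀ t ∈ Set.Ioo (0 : unitInterval) 1, arc e s ≠ arc f t

/-- A graph is planar if it can be drawn in the plane without crossings. -/
def IsPlanar {V : Type*} (G : SimpleGraph V) : Prop := Nonempty (PlaneDrawing G)

/-! ### The non-planarity game -/

/-- The board `E(K_n)`, where `K_n` is the complete graph on the vertex set `Fin n`. -/
def completeBoard (n : ℕ) : Finset (Sym2 (Fin n)) := (⊤ : SimpleGraph (Fin n)).edgeFinset

/-- The winning sets of the non-planarity game on `E(K_n)`: the edge sets of the non-planar graphs
on the vertex set `Fin n`. -/
def nonPlanarSets (n : ℕ) : Set (Finset (Sym2 (Fin n))) :=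
  {A | A ⊆ completeBoard n ∧
    ¬ IsPlanar (SimpleGraph.fromEdgeSet (A : Set (Sym2 (Fin n))))}

/-! Maker keeps his graph at maximum degree at most `Δ` and free of cycles of length at most `K`,
and he stops caring once he has about `(1 + ε) n` edges. When he owns `m ≤ (1 + ε) n` edges, Breaker
owns at most `b m ≤ (1/2 - ε/2 - ε²) n²`. The pairs Maker must avoid have an endpoint of degree `Δ`
or lie at distance at most `K`; there are at most `ε n² / 4 + O(n)` of them. So for large `n` a
suitable free edge always remains (`claimed_add_forbidden_lt`, `exists_insert_isLocallySparse`).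

The resulting graph is non-planar (`not_isPlanar_of_isLocallySparse`). The argument replaces Euler's
formula by minors. A drawing gives disjoint path-connected stars, one per vertex, with
path-connected unions along edges (`TouchingFamily`); such families survive contraction. By Mader's
argument, 16 edges per vertex would force five pairwise touching sets, which a winding number parity
excludes (`false_of_drawing_five`). So planar touching families have fewer than 16 edges per vertex.

Now take a minimal, hence connected, vertex set `S` spanning at least `(1 + ε)|S|` edges, and cut a
breadth-first tree of it into at most `|S|/r + 1` clusters of bounded size. As short cycles are
absent, clusters induce trees and two clusters are joined by at most one edge. Contracting them
leaves at least `ε|S| + |R|` edges on the set `R` of clusters, which is at least `16|R|` when `r` is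
large: a contradiction. -/

/-! ### Winding numbers and the non-planarity of `K₅`. -/

open Complex in
/-- A nowhere vanishing continuous function on a simply connected space has a logarithm. -/
theorem exists_continuous_log {X : Type*} [TopologicalSpace X] [LocallyPathConnectedSpace X]
    [SimplyConnectedSpace X] {g : X → ℂ} (hg : Continuous g) (h0 : ∀ x, g x ≠ 0) :
    ∃ L : X → ℂ, Continuous L ∧ ∀ x, exp (L x) = g x := by
  obtain ⟨x₀⟩ : Nonempty X := inferInstance
  obtain ⟨L, ⟨-, hL⟩, -⟩ := isCoveringMapOn_exp.existsUnique_continuousMap_lifts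
    (⟨g, hg⟩ : C(X, ℂ)) (exp_log (h0 x₀)) h0
  exact ⟨L, L.continuous, fun x => congrFun hL x⟩

open Complex in
/-- Two continuous logarithms of the same function differ by a constant. -/
theorem sub_eq_sub_of_exp_eq {f g : ℝ → ℂ} (hf : Continuous f) (hg : Continuous g)
    (h : ∀ t, exp (f t) = exp (g t)) (s t : ℝ) : f s - f t = g s - g t := by
  have key : ∀ x, ∃ n : ℤ, f x - g x = n * (2 * Real.pi * I) := fun x => by
    obtain ⟨n, hn⟩ := exp_eq_exp_iff_exists_int.mp (h x)
    exact ⟨n, by rw [hn]; ring⟩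
  choose n hn using key
  have hc : Continuous n := by
    rw [Int.isClosedEmbedding_coe_real.isEmbedding.continuous_iff]
    have : (fun x => (n x : ℝ)) = fun x => ((f x - g x) / (2 * Real.pi * I)).re := by
      funext x
      rw [hn, mul_div_assoc, div_self two_pi_I_ne_zero]
      simp
    change Continuous fun x => (n x : ℝ)
    rw [this]
    fun_prop
  have hnc : n s = n t := PreconnectedSpace.constant inferInstance hc
  have h1 := hn s
  have h2 := hn t
  rw [hnc] at h1
  linear_combination h1 - h2

open Complex in
/-- The total change of a continuous logarithm around a square is zero, when the sides are
computed separately. -/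
theorem log_change_square {a b : ℝ → ℂ} (ha : Continuous a) (hb : Continuous b)
    (hab : ∀ s t, a s ≠ b t) {L₀ L₁ K₀ K₁ : ℝ → ℂ}
    (hL₀ : Continuous L₀) (hL₁ : Continuous L₁) (hK₀ : Continuous K₀) (hK₁ : Continuous K₁)
    (eL₀ : ∀ t, exp (L₀ t) = a 0 - b t) (eL₁ : ∀ t, exp (L₁ t) = a 1 - b t)
    (eK₀ : ∀ s, exp (K₀ s) = b 0 - a s) (eK₁ : ∀ s, exp (K₁ s) = b 1 - a s) :
    (L₀ 1 - L₀ 0) + (K₁ 1 - K₁ 0) = (K₀ 1 - K₀ 0) + (L₁ 1 - L₁ 0) := by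
  obtain ⟨L, hL, eL⟩ := exists_continuous_log (X := ℝ × ℝ) (g := fun p => a p.1 - b p.2)
    (by fun_prop) (fun p => sub_ne_zero.mpr (hab _ _))
  have h1 := sub_eq_sub_of_exp_eq (f := fun t => L (0, t)) (by fun_prop) hL₀
    (fun t => by rw [eL, eL₀]) 1 0
  have h2 := sub_eq_sub_of_exp_eq (f := fun t => L (1, t)) (by fun_prop) hL₁
    (fun t => by rw [eL, eL₁]) 1 0
  -- `K₀` and `K₁` are logarithms of `b - a`, not `a - b`; the constant `π i` corrects the sign and
  -- cancels in differences.
  have h3 := sub_eq_sub_of_exp_eq (f := fun t => L (t, 0)) (g := fun t => K₀ t + Real.pi * I)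
    (by fun_prop) (by fun_prop) (fun t => by rw [eL, exp_add, eK₀, exp_pi_mul_I]; ring) 1 0
  have h4 := sub_eq_sub_of_exp_eq (f := fun t => L (t, 1)) (g := fun t => K₁ t + Real.pi * I)
    (by fun_prop) (by fun_prop) (fun t => by rw [eL, exp_add, eK₁, exp_pi_mul_I]; ring) 1 0
  linear_combination -h1 + h2 + h3 - h4

/-- `1` if `i < j` and `-1` otherwise. -/
def orderSign (i j : Fin 5) : ℤ := if i < j then 1 else -1

/-- A drawing of `K₅` always has two disjoint edges which cross. -/
theorem false_of_drawing_five (p : Fin 5 → ℂ) (γ : Fin 5 → Fin 5 → ℝ → ℂ)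
    (hγ : ∀ i j, Continuous (γ i j))
    (h0 : ∀ i j, i < j → γ i j 0 = p i) (h1 : ∀ i j, i < j → γ i j 1 = p j)
    (hp : ∀ i j, i ≠ j → p i ≠ p j)
    (hv : ∀ k i j, i < j → k ≠ i → k ≠ j → ∀ t, p k ≠ γ i j t)
    (he : ∀ i j k l, i < j → k < l → i ≠ k → i ≠ l → j ≠ k → j ≠ l →
      ∀ s t, γ i j s ≠ γ k l t) : False := by
  -- Reference logarithms of `p i - p j`, chosen so that reversing a pair changes them by exactly `±
  -- π i`. Against them, the turning of an edge seen from a third vertex becomes an integer `n`.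
  have hφ : ∃ φ : Fin 5 → Fin 5 → ℂ, (∀ i j, i ≠ j → Complex.exp (φ i j) = p i - p j) ∧
      ∀ i j, i ≠ j → φ i j - φ j i = orderSign i j * (Real.pi * Complex.I) := by
    refine ⟨fun i j => if i < j then Complex.log (p j - p i) + Real.pi * Complex.I
      else Complex.log (p i - p j), fun i j hij => ?_, fun i j hij => ?_⟩
    · dsimp only
      split_ifs
      · rw [Complex.exp_add, Complex.exp_log (sub_ne_zero.mpr (hp j i hij.symm)),
          Complex.exp_pi_mul_I]
        ring
      · rw [Complex.exp_log (sub_ne_zero.mpr (hp i j hij))]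
    · rcases lt_or_gt_of_ne hij with h | h
      · simp [h, h.not_gt, orderSign]
      · simp [h, h.not_gt, orderSign]
  obtain ⟨φ, hφ, hσ⟩ := hφ
  have hL : ∀ k i j, ∃ L : ℝ → ℂ, i < j → k ≠ i → k ≠ j →
      Continuous L ∧ ∀ t, Complex.exp (L t) = p k - γ i j t := by
    intro k i j
    by_cases h : i < j ∧ k ≠ i ∧ k ≠ j
    · obtain ⟨L, hL, eL⟩ := exists_continuous_log (g := fun t => p k - γ i j t)
        (by have := hγ i j; fun_prop) (fun t => sub_ne_zero.mpr (hv k i j h.1 h.2.1 h.2.2 t))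
      exact ⟨L, fun _ _ _ => ⟨hL, eL⟩⟩
    · exact ⟨0, fun a b c => (h ⟨a, b, c⟩).elim⟩
  choose L hL using hL
  have hn : ∀ k i j, ∃ n : ℤ, i < j → k ≠ i → k ≠ j →
      L k i j 1 - L k i j 0 = φ k j - φ k i + 2 * n * (Real.pi * Complex.I) := by
    intro k i j
    by_cases h : i < j ∧ k ≠ i ∧ k ≠ j
    · obtain ⟨-, eL⟩ := hL k i j h.1 h.2.1 h.2.2
      have e1 : Complex.exp (L k i j 1) = Complex.exp (φ k j) := by
        rw [eL, h1 i j h.1, hφ k j h.2.2]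
      have e0 : Complex.exp (L k i j 0) = Complex.exp (φ k i) := by
        rw [eL, h0 i j h.1, hφ k i h.2.1]
      obtain ⟨n, hn⟩ := Complex.exp_eq_exp_iff_exists_int.mp e1
      obtain ⟨m, hm⟩ := Complex.exp_eq_exp_iff_exists_int.mp e0
      exact ⟨n - m, fun _ _ _ => by rw [hn, hm]; push_cast; ring⟩
    · exact ⟨0, fun a b c => (h ⟨a, b, c⟩).elim⟩
  choose n hn using hn
  have key : ∀ i j k l, i < j → k < l → i ≠ k → i ≠ l → j ≠ k → j ≠ l →
      orderSign i l + orderSign l j + orderSign j k + orderSign k i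
        + 2 * (n i k l + n l i j - n j k l - n k i j) = 0 := by
    intro i j k l hij hkl hik hil hjk hjl
    obtain ⟨c1, e1⟩ := hL i k l hkl hik hil
    obtain ⟨c2, e2⟩ := hL j k l hkl hjk hjl
    obtain ⟨c3, e3⟩ := hL k i j hij hik.symm hjk.symm
    obtain ⟨c4, e4⟩ := hL l i j hij hil.symm hjl.symm
    have := log_change_square (hγ i j) (hγ k l) (he i j k l hij hkl hik hil hjk hjl) c1 c2 c3 c4
      (by simpa [h0 i j hij] using e1) (by simpa [h1 i j hij] using e2)
      (by simpa [h0 k l hkl] using e3) (by simpa [h1 k l hkl] using e4)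
    rw [hn i k l hkl hik hil, hn j k l hkl hjk hjl, hn k i j hij hik.symm hjk.symm,
      hn l i j hij hil.symm hjl.symm] at this
    have hπ : (Real.pi * Complex.I : ℂ) ≠ 0 := by simp [Real.pi_ne_zero]
    have h2 : ((orderSign i l + orderSign l j + orderSign j k + orderSign k i
        + 2 * (n i k l + n l i j - n j k l - n k i j) : ℤ) : ℂ) * (Real.pi * Complex.I) = 0 := by
      push_cast
      linear_combination this - hσ i l hil - hσ l j hjl.symm - hσ j k hjk - hσ k i hik.symm
    exact_mod_cast (mul_eq_zero.mp h2).resolve_right hπ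
  have a1 := key 0 1 2 3 (by decide) (by decide) (by decide) (by decide) (by decide) (by decide)
  have a2 := key 0 1 2 4 (by decide) (by decide) (by decide) (by decide) (by decide) (by decide)
  have a3 := key 0 1 3 4 (by decide) (by decide) (by decide) (by decide) (by decide) (by decide)
  have a4 := key 0 2 1 3 (by decide) (by decide) (by decide) (by decide) (by decide) (by decide)
  have a5 := key 0 2 1 4 (by decide) (by decide) (by decide) (by decide) (by decide) (by decide)
  have a6 := key 0 2 3 4 (by decide) (by decide) (by decide) (by decide) (by decide) (by decide)
  have a7 := key 0 3 1 2 (by decide) (by decide) (by decide) (by decide) (by decide) (by decide)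
  have a8 := key 0 3 1 4 (by decide) (by decide) (by decide) (by decide) (by decide) (by decide)
  have a9 := key 0 3 2 4 (by decide) (by decide) (by decide) (by decide) (by decide) (by decide)
  have a10 := key 0 4 1 2 (by decide) (by decide) (by decide) (by decide) (by decide) (by decide)
  have a11 := key 0 4 1 3 (by decide) (by decide) (by decide) (by decide) (by decide) (by decide)
  have a12 := key 0 4 2 3 (by decide) (by decide) (by decide) (by decide) (by decide) (by decide)
  have a13 := key 1 2 3 4 (by decide) (by decide) (by decide) (by decide) (by decide) (by decide)
  have a14 := key 1 3 2 4 (by decide) (by decide) (by decide) (by decide) (by decide) (by decide)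
  have a15 := key 1 4 2 3 (by decide) (by decide) (by decide) (by decide) (by decide) (by decide)
  have o : ∀ i j, orderSign i j = if i < j then 1 else -1 := fun _ _ => rfl
  simp (decide := true) only [o, if_true, if_false]
    at a1 a2 a3 a4 a5 a6 a7 a8 a9 a10 a11 a12 a13 a14 a15
  -- Add the fifteen equations modulo 4. Each `n k i j` occurs in exactly two of them, with
  -- coefficient `± 2`, so these terms vanish. The order signs sum to `-2` for an interleaved pair
  -- of edges and to `0` otherwise; there are five interleaved pairs, one per 4-subset, and `-10` is
  -- not divisible by 4.
  omega

/-- There are no five pairwise disjoint sets in the plane whose pairwise unions are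
path-connected. -/
theorem false_of_five_touching (Q : Fin 5 → Set ℂ) (hne : ∀ i, (Q i).Nonempty)
    (hdisj : ∀ i j, i ≠ j → Disjoint (Q i) (Q j))
    (hconn : ∀ i j, i ≠ j → IsPathConnected (Q i ∪ Q j)) : False := by
  choose p hp using hne
  have hγ : ∀ i j, ∃ γ : ℝ → ℂ, Continuous γ ∧ (i < j → γ 0 = p i ∧ γ 1 = p j ∧
      ∀ t, γ t ∈ Q i ∪ Q j) := by
    intro i j
    by_cases h : i < j
    · have hj := (hconn i j h.ne).joinedIn (p i) (Or.inl (hp i)) (p j) (Or.inr (hp j))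
      refine ⟨hj.somePath.extend, hj.somePath.continuous_extend, fun _ => ⟨by simp, by simp, ?_⟩⟩
      intro t
      exact hj.somePath_mem _
    · exact ⟨0, continuous_const, fun h' => (h h').elim⟩
  choose γ hc hγ using hγ
  have hnot : ∀ i j x, i ≠ j → x ∈ Q i → x ∉ Q j := fun i j x hij hi hj =>
    Set.disjoint_left.mp (hdisj i j hij) hi hj
  refine false_of_drawing_five p γ hc (fun i j h => (hγ i j h).1) (fun i j h => (hγ i j h).2.1)
    ?_ ?_ ?_
  · intro i j hij h
    exact hnot i j _ hij (hp i) (h ▸ hp j)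
  · intro k i j hij hki hkj t h
    rcases h ▸ (hγ i j hij).2.2 t with h' | h'
    · exact hnot k i _ hki (hp k) h'
    · exact hnot k j _ hkj (hp k) h'
  · intro i j k l hij hkl hik hil hjk hjl s t h
    have h2 := (hγ k l hkl).2.2 t
    rw [← h] at h2
    rcases (hγ i j hij).2.2 s with h1 | h1 <;> rcases h2 with h2 | h2
    · exact hnot _ _ _ hik h1 h2
    · exact hnot _ _ _ hil h1 h2
    · exact hnot _ _ _ hjk h1 h2
    · exact hnot _ _ _ hjl h1 h2

/-! ### Touching families, contraction and Mader's density argument. -/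

theorem card_le_two_mul_card_image_mk {V : Type*} [DecidableEq V] (A : Finset (V × V)) :
    A.card ≤ 2 * (A.image fun p => s(p.1, p.2)).card := by
  refine Finset.card_le_mul_card_image _ _ fun e _ => ?_
  induction e using Sym2.ind with
  | _ x y =>
    refine (Finset.card_le_card (t := {(x, y), (y, x)}) fun p hp => ?_).trans Finset.card_le_two
    obtain ⟨a, b⟩ := p
    simpa using (Finset.mem_filter.mp hp).2

/-- A family of pairwise disjoint path-connected sets indexed by `X`, and a set `M` of pairs of
indices such that the union of the two sets of a pair is path-connected. -/
structure TouchingFamily {V E : Type*} [TopologicalSpace E]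
    (P : V → Set E) (X : Finset V) (M : Finset (Sym2 V)) : Prop where
  conn : ∀ v ∈ X, IsPathConnected (P v)
  disj : ∀ u ∈ X, ∀ v ∈ X, u ≠ v → Disjoint (P u) (P v)
  ne : ∀ u v, s(u, v) ∈ M → u ≠ v
  mem : ∀ u v, s(u, v) ∈ M → u ∈ X
  edge : ∀ u v, s(u, v) ∈ M → IsPathConnected (P u ∪ P v)

namespace TouchingFamily

theorem mem' {V E : Type*} [TopologicalSpace E] {P : V → Set E} {X : Finset V}
    {M : Finset (Sym2 V)} (h : TouchingFamily P X M) {u v : V} (huv : s(u, v) ∈ M) : v ∈ X :=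
  h.mem v u (Sym2.eq_swap ▸ huv)

variable {V E : Type*} [DecidableEq V] [TopologicalSpace E] {P : V → Set E} {X : Finset V}
  {M : Finset (Sym2 V)}

theorem mono (h : TouchingFamily P X M) {N : Finset V} (hN : N ⊆ X) :
    TouchingFamily P N (M ∩ N.sym2) where
  conn v hv := h.conn v (hN hv)
  disj u hu v hv := h.disj u (hN hu) v (hN hv)
  ne u v huv := h.ne u v (Finset.mem_inter.mp huv).1
  mem u v huv := by
    have := (Finset.mem_inter.mp huv).2
    rw [Finset.mk_mem_sym2_iff] at this
    exact this.1
  edge u v huv := h.edge u v (Finset.mem_inter.mp huv).1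

/-- The map which identifies `v` with `u`. -/
def mergeInto (u v x : V) : V := if x = v then u else x

/-- Adjoining to a path-connected union `P a ∪ P b` the path-connected new sets of `a` and `b`, both
of which meet it, preserves path-connectedness. -/
theorem contract (h : TouchingFamily P X M) {u v : V} (huv : s(u, v) ∈ M) :
    TouchingFamily (fun x => if x = u then P u ∪ P v else P x) (X.erase v)
      ((M.erase s(u, v)).image (Sym2.map (mergeInto u v))) := by
  have hne := h.ne u v huv
  have hu := h.mem u v huv
  have hv := h.mem' huv
  have himage : ∀ x y, s(x, y) ∈ (M.erase s(u, v)).image (Sym2.map (mergeInto u v)) →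
      ∃ a b, s(a, b) ∈ M ∧ s(a, b) ≠ s(u, v) ∧ mergeInto u v a = x ∧ mergeInto u v b = y := by
    intro x y hxy
    obtain ⟨e, he, hexy⟩ := Finset.mem_image.mp hxy
    obtain ⟨he1, he2⟩ := Finset.mem_erase.mp he
    induction e using Sym2.ind with
    | _ a b =>
      rw [Sym2.map_mk, Sym2.eq_iff] at hexy
      rcases hexy with ⟨ha, hb⟩ | ⟨ha, hb⟩
      · exact ⟨a, b, he2, he1, ha, hb⟩
      · exact ⟨b, a, Sym2.eq_swap ▸ he2, Sym2.eq_swap ▸ he1, hb, ha⟩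
  refine ⟨fun x hx => ?_, fun x hx y hy hxy => ?_, fun x y hxy => ?_, fun x y hxy => ?_,
    fun x y hxy => ?_⟩
  · have hx := Finset.mem_of_mem_erase hx
    split_ifs
    exacts [h.edge u v huv, h.conn x hx]
  · obtain ⟨hxv, hx⟩ := Finset.mem_erase.mp hx
    obtain ⟨hyv, hy⟩ := Finset.mem_erase.mp hy
    split_ifs with h1 h2 h2
    · exact (hxy (h1.trans h2.symm)).elim
    · exact Set.disjoint_union_left.mpr ⟨h.disj u hu y hy (Ne.symm h2), h.disj v hv y hy hyv.symm⟩
    · exact Set.disjoint_union_right.mpr ⟨h.disj x hx u hu h1, h.disj x hx v hv hxv⟩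
    · exact h.disj x hx y hy hxy
  · obtain ⟨a, b, hab, hne', rfl, rfl⟩ := himage x y hxy
    have := h.ne a b hab
    unfold mergeInto
    intro heq
    split_ifs at heq with h1 h2 h2
    · exact this (h1.trans h2.symm)
    · exact hne' (by rw [h1, ← heq, Sym2.eq_swap])
    · exact hne' (by rw [h2, heq])
    · exact this heq
  · obtain ⟨a, b, hab, hne', rfl, rfl⟩ := himage x y hxy
    unfold mergeInto
    split_ifs with h1
    · exact Finset.mem_erase.mpr ⟨hne, hu⟩
    · exact Finset.mem_erase.mpr ⟨h1, h.mem a b hab⟩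
  · obtain ⟨a, b, hab, hne', rfl, rfl⟩ := himage x y hxy
    have key : ∀ c, P c ⊆ (if mergeInto u v c = u then P u ∪ P v else P (mergeInto u v c)) := by
      intro c
      by_cases h1 : c = v
      · simp [mergeInto, h1]
      · by_cases h2 : c = u
        · subst h2
          simp [mergeInto, h1]
        · simp [mergeInto, h1, h2]
    have hc : ∀ c ∈ X, IsPathConnected
        (if mergeInto u v c = u then P u ∪ P v else P (mergeInto u v c)) := by
      intro c hcX
      by_cases h1 : c = v
      · simpa [mergeInto, h1] using h.edge u v huv
      · by_cases h2 : c = u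
        · simpa [mergeInto, h1, h2] using h.edge u v huv
        · simpa [mergeInto, h1, h2] using h.conn c hcX
    have ha := h.mem a b hab
    have hb := h.mem' hab
    have e := ((h.edge a b hab).union (hc a ha)
      (((h.conn a ha).nonempty.mono fun z hz => ⟨Or.inl hz, key a hz⟩))).union (hc b hb)
      (((h.conn b hb).nonempty.mono fun z hz => ⟨Or.inl (Or.inr hz), key b hz⟩))
    convert e using 1
    refine Set.Subset.antisymm (Set.union_subset_union_left _ Set.subset_union_right) ?_
    exact Set.union_subset (Set.union_subset (Set.union_subset_union (key a) (key b))
      Set.subset_union_left) Set.subset_union_right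

/-- Contraction loses the edge `uv` itself and, for each common neighbour `w`, identifies `vw` with
`uw`. No other edges are identified. -/
theorem card_le_card_contract (h : TouchingFamily P X M) {u v : V} (huv : s(u, v) ∈ M) :
    M.card ≤ ((M.erase s(u, v)).image (Sym2.map (mergeInto u v))).card + 1 +
      (X.filter fun w => s(u, w) ∈ M ∧ s(v, w) ∈ M).card := by
  set C := X.filter fun w => s(u, w) ∈ M ∧ s(v, w) ∈ M with hC
  set T := C.image fun w => s(v, w) with hT
  have hinj : Set.InjOn (Sym2.map (mergeInto u v)) ((M.erase s(u, v)) \ T : Finset (Sym2 V)) := by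
    have hnot : ∀ w, s(v, w) ∈ (M.erase s(u, v)) \ T → s(u, w) ∉ M ∧ w ≠ v ∧ w ≠ u := by
      intro w hw
      obtain ⟨hw1, hw2⟩ := Finset.mem_sdiff.mp hw
      obtain ⟨hw3, hw4⟩ := Finset.mem_erase.mp hw1
      refine ⟨fun hu => hw2 (Finset.mem_image_of_mem _ (Finset.mem_filter.mpr
        ⟨h.mem' hw4, hu, hw4⟩)), (h.ne _ _ hw4).symm, ?_⟩
      rintro rfl
      exact hw3 Sym2.eq_swap
    have hfix : ∀ e : Sym2 V, v ∉ e → Sym2.map (mergeInto u v) e = e := by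
      intro e he
      induction e using Sym2.ind with
      | _ a b =>
        simp only [Sym2.mem_iff, not_or] at he
        simp [mergeInto, Ne.symm he.1, Ne.symm he.2]
    have hmix : ∀ w, ∀ e, s(v, w) ∈ (M.erase s(u, v)) \ T → e ∈ (M.erase s(u, v)) \ T →
        Sym2.map (mergeInto u v) s(v, w) = Sym2.map (mergeInto u v) e → s(v, w) = e := by
      intro w e hw he heq
      obtain ⟨n1, n2, n3⟩ := hnot w hw
      have himg : Sym2.map (mergeInto u v) s(v, w) = s(u, w) := by simp [mergeInto, n2]
      by_cases hve : v ∈ e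
      · obtain ⟨w', rfl⟩ := hve
        obtain ⟨m1, m2, m3⟩ := hnot w' he
        have himg' : Sym2.map (mergeInto u v) s(v, w') = s(u, w') := by simp [mergeInto, m2]
        rw [himg, himg'] at heq
        rw [Sym2.congr_right.mp heq]
      · rw [hfix e hve, himg] at heq
        exact (n1 (heq ▸ Finset.mem_of_mem_erase (Finset.mem_sdiff.mp he).1)).elim
    intro e he e' he' heq
    rw [Finset.mem_coe] at he he'
    by_cases h1 : v ∈ e
    · obtain ⟨w, rfl⟩ := h1
      exact hmix w e' he he' heq
    · by_cases h2 : v ∈ e'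
      · obtain ⟨w, rfl⟩ := h2
        exact (hmix w e he' he heq.symm).symm
      · rwa [hfix e h1, hfix e' h2] at heq
  have h1 := Finset.card_image_of_injOn hinj
  have h2 := Finset.card_le_card (Finset.image_subset_image (f := Sym2.map (mergeInto u v))
    (Finset.sdiff_subset (s := M.erase s(u, v)) (t := T)))
  have h3 : (M.erase s(u, v)).card ≤ T.card + ((M.erase s(u, v)) \ T).card := by
    have := Finset.le_card_sdiff T (M.erase s(u, v))
    omega
  have h4 := Finset.card_erase_add_one huv
  have h5 : T.card ≤ C.card := Finset.card_image_le
  omega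

/-- A touching family with at least `2 ^ t` pairs per set gives `t + 1` sets which touch
pairwise. -/
theorem exists_pairwise_touching (t : ℕ) (h : TouchingFamily P X M) (hX : X.Nonempty)
    (hM : 2 ^ t * X.card ≤ M.card) :
    ∃ Q : Fin (t + 1) → Set E, (∀ i, ∃ w ∈ X, P w ⊆ Q i) ∧ (∀ i, Q i ⊆ ⋃ x ∈ X, P x) ∧
      (∀ i j, i ≠ j → Disjoint (Q i) (Q j)) ∧ ∀ i j, IsPathConnected (Q i ∪ Q j) := by
  induction t generalizing P X M with
  | zero =>
    obtain ⟨x, hx⟩ := hX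
    refine ⟨fun _ => P x, fun _ => ⟨x, hx, subset_rfl⟩,
      fun _ => Set.subset_biUnion_of_mem (u := P) (Finset.mem_coe.mpr hx), ?_, ?_⟩
    · intro i j hij
      exact (hij (Subsingleton.elim (α := Fin 1) i j)).elim
    · intro i j
      rw [Set.union_self]
      exact h.conn x hx
  | succ t ih =>
    induction hm : X.card using Nat.strong_induction_on generalizing P X M with
    | _ m ihm =>
    subst hm
    -- If some edge has fewer than `2 ^ (t + 1)` common neighbours, contracting it costs one vertex
    -- and at most `2 ^ (t + 1)` edges, so the density bound persists. Otherwise every neighbourhood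
    -- has minimum degree at least `2 ^ (t + 1)`, hence density at least `2 ^ t`, and the set of the
    -- central vertex is added to the sets found there.
    by_cases hlow : ∃ u v, s(u, v) ∈ M ∧
        (X.filter fun w => s(u, w) ∈ M ∧ s(v, w) ∈ M).card + 1 ≤ 2 ^ (t + 1)
    · obtain ⟨u, v, huv, hc⟩ := hlow
      have hu := h.mem u v huv
      have hv := h.mem' huv
      have hcard := h.card_le_card_contract huv
      have hXc := Finset.card_erase_add_one hv
      obtain ⟨Q, hQ1, hQ2, hQ3⟩ := ihm _ (by omega) (h.contract huv)
        ⟨u, Finset.mem_erase.mpr ⟨h.ne u v huv, hu⟩⟩ (by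
          rw [← hXc, mul_add] at hM
          omega) rfl
      refine ⟨Q, fun i => ?_, fun i => ?_, hQ3⟩
      · obtain ⟨w, hw, hPw⟩ := hQ1 i
        refine ⟨w, Finset.mem_of_mem_erase hw, Set.Subset.trans ?_ hPw⟩
        split_ifs with hwu
        · rw [hwu]
          exact Set.subset_union_left
        · exact subset_rfl
      · refine (hQ2 i).trans (Set.iUnion₂_subset fun x hx => ?_)
        split_ifs with hxu
        · exact Set.union_subset (Set.subset_biUnion_of_mem (u := P) (Finset.mem_coe.mpr hu))
            (Set.subset_biUnion_of_mem (u := P) (Finset.mem_coe.mpr hv))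
        · exact Set.subset_biUnion_of_mem (u := P)
            (Finset.mem_coe.mpr (Finset.mem_of_mem_erase hx))
    · push Not at hlow
      have hMne : M.Nonempty := by
        rw [← Finset.card_pos]
        exact lt_of_lt_of_le (Nat.mul_pos (by positivity) hX.card_pos) hM
      obtain ⟨e, he⟩ := hMne
      induction e using Sym2.ind with
      | _ v w₀ =>
      set N := X.filter fun w => s(v, w) ∈ M with hN
      have hNX : N ⊆ X := Finset.filter_subset _ _
      have hMN : 2 ^ t * N.card ≤ (M ∩ N.sym2).card := by
        set A := (N ×ˢ N).filter fun p => s(p.1, p.2) ∈ M with hA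
        have h1 : N.card * 2 ^ (t + 1) ≤ A.card := by
          rw [hA, Finset.card_filter _ (N ×ˢ N), Finset.sum_product, ← smul_eq_mul]
          refine Finset.card_nsmul_le_sum _ _ _ fun w hw => ?_
          have hvw := (Finset.mem_filter.mp hw).2
          refine (Nat.lt_succ_iff.mp (hlow v w hvw)).trans ?_
          rw [← Finset.card_filter]
          refine Finset.card_le_card fun x hx => ?_
          obtain ⟨hx1, hx2, hx3⟩ := Finset.mem_filter.mp hx
          exact Finset.mem_filter.mpr ⟨Finset.mem_filter.mpr ⟨hx1, hx2⟩, hx3⟩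
        have h2 := card_le_two_mul_card_image_mk A
        have h3 : (A.image fun p => s(p.1, p.2)) ⊆ M ∩ N.sym2 := by
          intro e he
          obtain ⟨⟨a, b⟩, hab, rfl⟩ := Finset.mem_image.mp he
          simp only [hA, Finset.mem_filter, Finset.mem_product] at hab
          simp only [Finset.mem_inter, Finset.mk_mem_sym2_iff]
          exact ⟨hab.2, hab.1⟩
        have h4 := Finset.card_le_card h3
        rw [pow_succ] at h1
        have : N.card * (2 ^ t * 2) = 2 * (2 ^ t * N.card) := by ring
        omega
      obtain ⟨Q, hQ1, hQ2, hQ3, hQ4⟩ := ih (h.mono hNX)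
        ⟨w₀, Finset.mem_filter.mpr ⟨h.mem' he, he⟩⟩ hMN
      have hv := h.mem v w₀ he
      have hvQ : ∀ i, Disjoint (P v) (Q i) := by
        intro i
        refine Set.disjoint_of_subset_right (hQ2 i) (Set.disjoint_iUnion₂_right.mpr fun x hx => ?_)
        obtain ⟨hx1, hx2⟩ := Finset.mem_filter.mp hx
        exact h.disj v hv x hx1 (h.ne v x hx2)
      have hvQc : ∀ i, IsPathConnected (P v ∪ Q i) := by
        intro i
        obtain ⟨w, hw, hwQ⟩ := hQ1 i
        obtain ⟨hw1, hw2⟩ := Finset.mem_filter.mp hw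
        have hQi := hQ4 i i
        rw [Set.union_self] at hQi
        have := (h.edge v w hw2).union hQi
          ((h.conn w hw1).nonempty.mono fun z hz => ⟨Or.inr hz, hwQ hz⟩)
        rwa [Set.union_assoc, Set.union_eq_self_of_subset_left hwQ] at this
      refine ⟨Fin.cons (P v) Q, ?_, ?_, ?_, ?_⟩
      · refine Fin.cases ⟨v, hv, subset_rfl⟩ fun i => ?_
        obtain ⟨w, hw, hwQ⟩ := hQ1 i
        exact ⟨w, hNX hw, hwQ⟩
      · refine Fin.cases (Set.subset_biUnion_of_mem (u := P) (Finset.mem_coe.mpr hv)) fun i => ?_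
        exact (hQ2 i).trans (Set.biUnion_subset_biUnion_left (Finset.coe_subset.mpr hNX))
      · refine Fin.cases (Fin.cases (fun hh => (hh rfl).elim) fun j _ => ?_) fun i =>
          Fin.cases (fun _ => ?_) fun j hij => ?_
        · exact hvQ j
        · exact (hvQ i).symm
        · exact hQ3 i j fun hh => hij (by rw [hh])
      · refine Fin.cases (Fin.cases ?_ fun j => ?_) fun i => Fin.cases ?_ fun j => ?_
        · simpa using h.conn v hv
        · exact hvQc j
        · simpa [Set.union_comm] using hvQc i
        · exact hQ4 i j

/-- A touching family in the plane has fewer than `16` pairs per set. -/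
theorem card_lt {P : V → Set ℂ} (h : TouchingFamily P X M) (hX : X.Nonempty) :
    M.card < 16 * X.card := by
  by_contra hlt
  obtain ⟨Q, -, -, hQ1, hQ2⟩ := h.exists_pairwise_touching 4 hX (by omega)
  refine false_of_five_touching Q (fun i => ?_) hQ1 fun i j _ => hQ2 i j
  have := (hQ2 i i).nonempty
  rwa [Set.union_self] at this

end TouchingFamily

/-! ### Balls in the graph metric. -/

section Balls

variable {V : Type*} [DecidableEq V] [Fintype V]

/-- The set of the vertices which can be reached from `x` by at most `k` edges in `M`. -/
def edgeBall (M : Finset (Sym2 V)) : ℕ → V → Finset V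
  | 0, x => {x}
  | k + 1, x => edgeBall M k x ∪
      (edgeBall M k x).biUnion fun y => Finset.univ.filter fun z => s(y, z) ∈ M

variable {M : Finset (Sym2 V)} {x y z : V} {k : ℕ}

theorem mem_edgeBall_succ :
    z ∈ edgeBall M (k + 1) x ↔ z ∈ edgeBall M k x ∨ ∃ y ∈ edgeBall M k x, s(y, z) ∈ M := by
  simp [edgeBall]

theorem self_mem_edgeBall (M : Finset (Sym2 V)) (k : ℕ) (x : V) : x ∈ edgeBall M k x := by
  induction k with
  | zero => simp [edgeBall]
  | succ k ih => exact mem_edgeBall_succ.mpr (Or.inl ih)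

theorem edgeBall_mono {l : ℕ} (h : k ≤ l) : edgeBall M k x ⊆ edgeBall M l x := by
  induction l, h using Nat.le_induction with
  | base => exact subset_rfl
  | succ l _ ih => exact fun z hz => mem_edgeBall_succ.mpr (Or.inl (ih hz))

theorem edgeBall_mono_left {N : Finset (Sym2 V)} (h : N ⊆ M) :
    edgeBall N k x ⊆ edgeBall M k x := by
  induction k with
  | zero => exact subset_rfl
  | succ k ih =>
    intro z hz
    rcases mem_edgeBall_succ.mp hz with hz | ⟨y, hy, hyz⟩
    · exact mem_edgeBall_succ.mpr (Or.inl (ih hz))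
    · exact mem_edgeBall_succ.mpr (Or.inr ⟨y, ih hy, h hyz⟩)

theorem card_edgeBall_le {Δ : ℕ}
    (hΔ : ∀ v, (Finset.univ.filter fun w => s(v, w) ∈ M).card ≤ Δ) (k : ℕ) (x : V) :
    (edgeBall M k x).card ≤ (Δ + 1) ^ k := by
  induction k with
  | zero => simp [edgeBall]
  | succ k ih =>
    have h1 := Finset.card_biUnion_le_card_mul (edgeBall M k x)
      (fun y => Finset.univ.filter fun z => s(y, z) ∈ M) Δ fun y _ => hΔ y
    have h2 := Finset.card_union_le (edgeBall M k x)
      ((edgeBall M k x).biUnion fun y => Finset.univ.filter fun z => s(y, z) ∈ M)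
    calc (edgeBall M (k + 1) x).card ≤ (edgeBall M k x).card * (Δ + 1) := by
          rw [edgeBall]
          linarith
      _ ≤ (Δ + 1) ^ (k + 1) := by
          rw [pow_succ]
          exact Nat.mul_le_mul_right _ ih

theorem edgeBall_subset {X : Finset V} (hx : x ∈ X) :
    edgeBall (M ∩ X.sym2) k x ⊆ X := by
  induction k with
  | zero => simpa [edgeBall] using hx
  | succ k ih =>
    intro z hz
    rcases mem_edgeBall_succ.mp hz with hz | ⟨y, hy, hyz⟩
    · exact ih hz
    · exact (Finset.mk_mem_sym2_iff.mp (Finset.mem_inter.mp hyz).2).2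

/-- Balls grow strictly until they stabilise, so inside `X` a ball of radius at least `|X|` is a
whole connected component. -/
theorem mem_edgeBall_of_mem {X : Finset V} (hx : x ∈ X) (hX : X.card ≤ k)
    (hy : y ∈ edgeBall (M ∩ X.sym2) k x) (hyz : s(y, z) ∈ M ∩ X.sym2) :
    z ∈ edgeBall (M ∩ X.sym2) k x := by
  set N := M ∩ X.sym2 with hN
  have key : ∀ l, l + 1 ≤ (edgeBall N l x).card ∨ edgeBall N (l + 1) x ⊆ edgeBall N l x := by
    intro l
    induction l with
    | zero => exact Or.inl (by simp [edgeBall])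
    | succ l ih =>
      by_cases hsub : edgeBall N (l + 1) x ⊆ edgeBall N l x
      · refine Or.inr fun z hz => ?_
        rcases mem_edgeBall_succ.mp hz with hz | ⟨y, hy, hyz⟩
        · exact hz
        · exact mem_edgeBall_succ.mpr (Or.inr ⟨y, hsub hy, hyz⟩)
      · have := Finset.card_lt_card (Finset.ssubset_iff_subset_ne.mpr
          ⟨edgeBall_mono (M := N) (x := x) (Nat.le_add_right l 1), fun h => hsub h.symm.subset⟩)
        have h2 := ih.resolve_right hsub
        exact Or.inl (by omega)
  have hlt := Finset.card_le_card (edgeBall_subset (M := M) (k := k) hx)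
  rw [← hN] at hlt
  exact (key k).resolve_left (by omega) (mem_edgeBall_succ.mpr (Or.inr ⟨y, hy, hyz⟩))

end Balls

/-! ### Graphs without short cycles. -/

section Sparse

variable {V : Type*} [DecidableEq V] {M : Finset (Sym2 V)}

theorem inter_sym2_subset_union {X A : Finset V}
    (hA : ∀ y ∈ A, ∀ z ∈ X, s(y, z) ∈ M → z ∈ A) :
    M ∩ X.sym2 ⊆ (M ∩ A.sym2) ∪ (M ∩ (X \ A).sym2) := by
  intro e he
  obtain ⟨he, heX⟩ := Finset.mem_inter.mp he
  induction e using Sym2.ind with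
  | _ y z =>
    obtain ⟨hy, hz⟩ := Finset.mk_mem_sym2_iff.mp heX
    simp only [Finset.mem_union, Finset.mem_inter, Finset.mk_mem_sym2_iff, Finset.mem_sdiff]
    by_cases h1 : y ∈ A
    · exact Or.inl ⟨he, h1, hA y h1 z hz he⟩
    · by_cases h2 : z ∈ A
      · exact (h1 (hA z h2 y hy (Sym2.eq_swap ▸ he))).elim
      · exact Or.inr ⟨he, ⟨hy, h1⟩, hz, h2⟩

/-- Every nonempty set of at most `K` vertices spans fewer edges than it has vertices, so `M` has
no cycle of length at most `K`. -/
def IsLocallySparse (K : ℕ) (M : Finset (Sym2 V)) : Prop :=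
  ∀ X : Finset V, X.Nonempty → X.card ≤ K → (M ∩ X.sym2).card < X.card

/-- Inside `X`, the component `A` of `x` misses `y`. Both `A` and `X \ A` span fewer edges than
vertices, which leaves a surplus of two, and the new edge uses only one. -/
theorem IsLocallySparse.insert [Fintype V] {K : ℕ} (h : IsLocallySparse K M) {x y : V}
    (hxy : y ∉ edgeBall M K x) : IsLocallySparse K (insert s(x, y) M) := by
  intro X hX hK
  by_cases hmem : s(x, y) ∈ X.sym2
  · obtain ⟨hx, hy⟩ := Finset.mk_mem_sym2_iff.mp hmem
    set A := edgeBall (M ∩ X.sym2) K x with hA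
    have hAX : A ⊆ X := edgeBall_subset hx
    have hyA : y ∉ A := fun hyA => hxy (edgeBall_mono_left Finset.inter_subset_left hyA)
    have hsub := inter_sym2_subset_union (M := M) (X := X) (A := A) fun u hu v hv huv =>
      mem_edgeBall_of_mem hx hK hu
        (Finset.mem_inter.mpr ⟨huv, Finset.mk_mem_sym2_iff.mpr ⟨hAX hu, hv⟩⟩)
    have h1 := h A ⟨x, self_mem_edgeBall _ _ _⟩ ((Finset.card_le_card hAX).trans hK)
    have h2 := h (X \ A) ⟨y, Finset.mem_sdiff.mpr ⟨hy, hyA⟩⟩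
      ((Finset.card_le_card Finset.sdiff_subset).trans hK)
    have h3 := (Finset.card_le_card hsub).trans (Finset.card_union_le _ _)
    have h4 := Finset.card_sdiff_add_card_eq_card hAX
    have h5 := Finset.card_insert_le s(x, y) (M ∩ X.sym2)
    rw [Finset.insert_inter_of_mem hmem]
    omega
  · rw [Finset.insert_inter_of_notMem hmem]
    exact h X hX hK

end Sparse

/-! ### Clusterings and their contraction. -/

/-- A partition of `S` into the fibres of a map `f` onto a set `R` of roots, such that every vertex
which is not a root has a parent in its fibre. -/
structure IsClustering {V : Type*} (M : Finset (Sym2 V)) (S R : Finset V) (f π : V → V)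
    (d : V → ℕ) : Prop where
  subset : R ⊆ S
  map_mem : ∀ v ∈ S, f v ∈ R
  map_root : ∀ v ∈ R, f v = v
  parent_mem : ∀ v ∈ S, v ∉ R → π v ∈ S
  parent_adj : ∀ v ∈ S, v ∉ R → s(v, π v) ∈ M
  depth_parent : ∀ v ∈ S, v ∉ R → d (π v) + 1 = d v
  map_parent : ∀ v ∈ S, v ∉ R → f (π v) = f v

namespace IsClustering

variable {V : Type*} [DecidableEq V] {M : Finset (Sym2 V)} {S R : Finset V} {f π : V → V}
  {d : V → ℕ}

/-- The edges to the parents are distinct, because depth drops by one along each; so a cluster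
contains a spanning tree. -/
theorem card_fiber_le (h : IsClustering M S R f π d) {c : V} :
    (S.filter (f · = c)).card ≤ (M ∩ (S.filter (f · = c)).sym2).card + 1 := by
  set C := S.filter (f · = c) with hC
  have hnot : ∀ v ∈ C.erase c, v ∈ S ∧ f v = c ∧ v ∉ R := by
    intro v hv
    obtain ⟨hvc, hv⟩ := Finset.mem_erase.mp hv
    obtain ⟨hvS, hfv⟩ := Finset.mem_filter.mp hv
    exact ⟨hvS, hfv, fun hvR => hvc (by rw [← hfv, h.map_root v hvR])⟩
  have h1 : (C.erase c).card ≤ (M ∩ C.sym2).card := by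
    refine Finset.card_le_card_of_injOn (fun v => s(v, π v)) (fun v hv => ?_) fun v hv w hw hvw => ?_
    · obtain ⟨hvS, hfv, hvR⟩ := hnot v hv
      refine Finset.mem_coe.mpr (Finset.mem_inter.mpr ⟨h.parent_adj v hvS hvR,
        Finset.mk_mem_sym2_iff.mpr ⟨Finset.mem_of_mem_erase hv, Finset.mem_filter.mpr
          ⟨h.parent_mem v hvS hvR, (h.map_parent v hvS hvR).trans hfv⟩⟩⟩)
    · obtain ⟨hvS, -, hvR⟩ := hnot v hv
      obtain ⟨hwS, -, hwR⟩ := hnot w hw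
      have e1 := h.depth_parent v hvS hvR
      have e2 := h.depth_parent w hwS hwR
      rcases Sym2.eq_iff.mp hvw with ⟨h1, -⟩ | ⟨h1, h2⟩
      · exact h1
      · rw [h2] at e1
        rw [← h1] at e2
        omega
  have h2 := Finset.pred_card_le_card_erase (s := C) (a := c)
  omega

theorem sum_card_fiber (h : IsClustering M S R f π d) :
    ∑ c ∈ R, (S.filter (f · = c)).card = S.card :=
  (Finset.card_eq_sum_card_fiberwise h.map_mem).symm

/-- The pairs in `S` which join different clusters. -/
def crossing (M : Finset (Sym2 V)) (S : Finset V) (f : V → V) : Finset (Sym2 V) :=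
  (M ∩ S.sym2).filter fun e => ¬ (Sym2.map f e).IsDiag

/-- By local sparsity each cluster spans at most its size minus one edges, so at most `|S| - |R|`
edges lie inside clusters. -/
theorem card_le_card_crossing {K : ℕ} (h : IsClustering M S R f π d) (hM : IsLocallySparse K M)
    (hK : ∀ c, (S.filter (f · = c)).card ≤ K) :
    (M ∩ S.sym2).card + R.card ≤ (crossing M S f).card + S.card := by
  have h1 := Finset.card_filter_add_card_filter_not (s := M ∩ S.sym2)
    (fun e => (Sym2.map f e).IsDiag)
  have h2 : ((M ∩ S.sym2).filter fun e => (Sym2.map f e).IsDiag) ⊆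
      R.biUnion fun c => M ∩ (S.filter (f · = c)).sym2 := by
    intro e he
    obtain ⟨he, hdiag⟩ := Finset.mem_filter.mp he
    obtain ⟨heM, heS⟩ := Finset.mem_inter.mp he
    induction e using Sym2.ind with
    | _ a b =>
      obtain ⟨ha, hb⟩ := Finset.mk_mem_sym2_iff.mp heS
      rw [Sym2.map_mk, Sym2.mk_isDiag_iff] at hdiag
      refine Finset.mem_biUnion.mpr ⟨f a, h.map_mem a ha, Finset.mem_inter.mpr ⟨heM,
        Finset.mk_mem_sym2_iff.mpr ⟨Finset.mem_filter.mpr ⟨ha, rfl⟩,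
          Finset.mem_filter.mpr ⟨hb, hdiag.symm⟩⟩⟩⟩
  have h3 := (Finset.card_le_card h2).trans Finset.card_biUnion_le
  have h4 : ∑ c ∈ R, ((M ∩ (S.filter (f · = c)).sym2).card + 1) ≤
      ∑ c ∈ R, (S.filter (f · = c)).card := Finset.sum_le_sum fun c hc =>
    hM _ ⟨c, Finset.mem_filter.mpr ⟨h.subset hc, h.map_root c hc⟩⟩ (hK c)
  rw [h.sum_card_fiber, Finset.sum_add_distrib, Finset.sum_const, smul_eq_mul, mul_one] at h4
  unfold crossing
  omega

/-- Two edges between clusters `A` and `B`, together with their spanning trees, would give at least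
`|A| + |B|` edges on `A ∪ B`, against local sparsity. -/
theorem injOn_crossing {K : ℕ} (h : IsClustering M S R f π d) (hM : IsLocallySparse K M)
    (hK : ∀ c, 2 * (S.filter (f · = c)).card ≤ K) :
    Set.InjOn (Sym2.map f) (crossing M S f : Finset (Sym2 V)) := by
  have key : ∀ a b a' b', s(a, b) ∈ crossing M S f → s(a', b') ∈ crossing M S f →
      f a = f a' → f b = f b' → s(a, b) = s(a', b') := by
    intro a b a' b' he he' hfa hfb
    by_contra hne
    simp only [crossing, Finset.mem_filter, Finset.mem_inter, Finset.mk_mem_sym2_iff,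
      Sym2.map_mk, Sym2.mk_isDiag_iff] at he he'
    set A := S.filter (f · = f a) with hA
    set B := S.filter (f · = f b) with hB
    have hAB : Disjoint A B := Finset.disjoint_left.mpr fun v hv hv' =>
      he.2 ((Finset.mem_filter.mp hv).2.symm.trans (Finset.mem_filter.mp hv').2)
    have haA : a ∈ A := Finset.mem_filter.mpr ⟨he.1.2.1, rfl⟩
    have hbB : b ∈ B := Finset.mem_filter.mpr ⟨he.1.2.2, rfl⟩
    have haA' : a' ∈ A := Finset.mem_filter.mpr ⟨he'.1.2.1, hfa.symm⟩
    have hbB' : b' ∈ B := Finset.mem_filter.mpr ⟨he'.1.2.2, hfb.symm⟩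
    have hnA : ∀ v ∈ A, v ∉ B := fun v hv => Finset.disjoint_left.mp hAB hv
    have hd1 : Disjoint (M ∩ A.sym2) (M ∩ B.sym2) := by
      refine Finset.disjoint_left.mpr fun e => Sym2.ind (fun u v h1 h2 => ?_) e
      simp only [Finset.mem_inter, Finset.mk_mem_sym2_iff] at h1 h2
      exact hnA u h1.2.1 h2.2.1
    have hd2 : Disjoint ((M ∩ A.sym2) ∪ (M ∩ B.sym2)) {s(a, b), s(a', b')} := by
      refine Finset.disjoint_right.mpr fun e he1 he2 => ?_
      simp only [Finset.mem_insert, Finset.mem_singleton] at he1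
      rcases he1 with rfl | rfl
      · simp only [Finset.mem_union, Finset.mem_inter, Finset.mk_mem_sym2_iff] at he2
        rcases he2 with he2 | he2
        · exact hnA b he2.2.2 hbB
        · exact hnA a haA he2.2.1
      · simp only [Finset.mem_union, Finset.mem_inter, Finset.mk_mem_sym2_iff] at he2
        rcases he2 with he2 | he2
        · exact hnA b' he2.2.2 hbB'
        · exact hnA a' haA' he2.2.1
    have hsub : ((M ∩ A.sym2) ∪ (M ∩ B.sym2)) ∪ {s(a, b), s(a', b')} ⊆ M ∩ (A ∪ B).sym2 := by
      refine Finset.union_subset (Finset.union_subset ?_ ?_) fun e he1 => ?_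
      · exact Finset.inter_subset_inter_left (Finset.sym2_mono Finset.subset_union_left)
      · exact Finset.inter_subset_inter_left (Finset.sym2_mono Finset.subset_union_right)
      · simp only [Finset.mem_insert, Finset.mem_singleton] at he1
        rcases he1 with rfl | rfl
        · simp [he.1.1, haA, hbB]
        · simp [he'.1.1, haA', hbB']
    have hc := Finset.card_le_card hsub
    rw [Finset.card_union_of_disjoint hd2, Finset.card_union_of_disjoint hd1,
      Finset.card_pair hne] at hc
    have hX := hM (A ∪ B) ⟨a, Finset.mem_union_left _ haA⟩ (by
      rw [Finset.card_union_of_disjoint hAB]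
      have : 2 * A.card ≤ K := hK (f a)
      have : 2 * B.card ≤ K := hK (f b)
      omega)
    rw [Finset.card_union_of_disjoint hAB] at hX
    have e1 := h.card_fiber_le (c := f a)
    have e2 := h.card_fiber_le (c := f b)
    rw [← hA] at e1
    rw [← hB] at e2
    omega
  intro e he e' he' heq
  induction e using Sym2.ind with
  | _ a b =>
    induction e' using Sym2.ind with
    | _ a' b' =>
      rw [Sym2.map_mk, Sym2.map_mk] at heq
      rcases Sym2.eq_iff.mp heq with ⟨h1, h2⟩ | ⟨h1, h2⟩
      · exact key a b a' b' he he' h1 h2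
      · rw [Sym2.eq_swap (a := a') (b := b')] at he' ⊢
        exact key a b b' a' he he' h1 h2

/-- Contracts every cluster at once: its union is path-connected because each vertex is joined to
the root through its chain of parents. -/
theorem touchingFamily {E : Type*} [TopologicalSpace E] {P : V → Set E} {X : Finset V}
    (h : IsClustering M S R f π d) (hP : TouchingFamily P X M) (hSX : S ⊆ X) :
    TouchingFamily (fun c => ⋃ v ∈ S.filter (f · = c), P v) R
      ((crossing M S f).image (Sym2.map f)) := by
  set P' : V → Set E := fun c => ⋃ v ∈ S.filter (f · = c), P v with hP'
  have hsub : ∀ v ∈ S, P v ⊆ P' (f v) := fun v hv =>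
    Set.subset_biUnion_of_mem (u := P) (Finset.mem_coe.mpr (Finset.mem_filter.mpr ⟨hv, rfl⟩))
  have hconn : ∀ c ∈ R, IsPathConnected (P' c) := by
    intro c hc
    have hcS := h.subset hc
    have hfc := h.map_root c hc
    obtain ⟨x₀, hx₀⟩ := (hP.conn c (hSX hcS)).nonempty
    have hx₀' : x₀ ∈ P' c := by simpa [hfc] using hsub c hcS hx₀
    have key : ∀ k, ∀ v ∈ S, d v = k → f v = c → ∀ x ∈ P v, JoinedIn (P' c) x₀ x := by
      intro k
      induction k with
      | zero =>
        intro v hv hd hfv x hx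
        have hvR : v ∈ R := by
          by_contra hvR
          have := h.depth_parent v hv hvR
          omega
        have hvc : v = c := by rw [← hfv, h.map_root v hvR]
        subst hvc
        exact ((hP.conn v (hSX hv)).joinedIn x₀ hx₀ x hx).mono (by simpa [hfv] using hsub v hv)
      | succ k ih =>
        intro v hv hd hfv x hx
        by_cases hvR : v ∈ R
        · have hvc : v = c := by rw [← hfv, h.map_root v hvR]
          subst hvc
          exact ((hP.conn v (hSX hv)).joinedIn x₀ hx₀ x hx).mono (by simpa [hfv] using hsub v hv)
        · have hπS := h.parent_mem v hv hvR
          have hfπ := (h.map_parent v hv hvR).trans hfv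
          obtain ⟨y, hy⟩ := (hP.conn (π v) (hSX hπS)).nonempty
          refine (ih (π v) hπS (by have := h.depth_parent v hv hvR; omega) hfπ y hy).trans ?_
          refine ((hP.edge v (π v) (h.parent_adj v hv hvR)).joinedIn y (Or.inr hy) x
            (Or.inl hx)).mono (Set.union_subset ?_ ?_)
          · simpa [hfv] using hsub v hv
          · simpa [hfπ] using hsub (π v) hπS
    refine ⟨x₀, hx₀', fun {x} hx => ?_⟩
    obtain ⟨v, hv, hxv⟩ := Set.mem_iUnion₂.mp hx
    obtain ⟨hvS, hfv⟩ := Finset.mem_filter.mp hv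
    exact key _ v hvS rfl hfv x hxv
  have himage : ∀ x y, s(x, y) ∈ (crossing M S f).image (Sym2.map f) →
      ∃ a ∈ S, ∃ b ∈ S, s(a, b) ∈ M ∧ f a ≠ f b ∧ f a = x ∧ f b = y := by
    intro x y hxy
    obtain ⟨e, he, hexy⟩ := Finset.mem_image.mp hxy
    induction e using Sym2.ind with
    | _ a b =>
      simp only [crossing, Finset.mem_filter, Finset.mem_inter, Finset.mk_mem_sym2_iff,
        Sym2.map_mk, Sym2.mk_isDiag_iff] at he
      obtain ⟨⟨heM, ha, hb⟩, hne⟩ := he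
      rw [Sym2.map_mk] at hexy
      rcases Sym2.eq_iff.mp hexy with ⟨h1, h2⟩ | ⟨h1, h2⟩
      · exact ⟨a, ha, b, hb, heM, hne, h1, h2⟩
      · exact ⟨b, hb, a, ha, Sym2.eq_swap ▸ heM, Ne.symm hne, h2, h1⟩
  refine ⟨hconn, fun x _ y _ hxy => ?_, fun x y hxy => ?_, fun x y hxy => ?_, fun x y hxy => ?_⟩
  · refine Set.disjoint_iUnion₂_left.mpr fun a ha => Set.disjoint_iUnion₂_right.mpr fun b hb => ?_
    obtain ⟨haS, rfl⟩ := Finset.mem_filter.mp ha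
    obtain ⟨hbS, rfl⟩ := Finset.mem_filter.mp hb
    exact hP.disj a (hSX haS) b (hSX hbS) fun hab => hxy (by rw [hab])
  · obtain ⟨a, ha, b, hb, -, hne, rfl, rfl⟩ := himage x y hxy
    exact hne
  · obtain ⟨a, ha, b, hb, -, hne, rfl, rfl⟩ := himage x y hxy
    exact h.map_mem a ha
  · obtain ⟨a, ha, b, hb, hab, -, rfl, rfl⟩ := himage x y hxy
    have e := ((hP.edge a b hab).union (hconn _ (h.map_mem a ha))
      ((hP.conn a (hSX ha)).nonempty.mono fun z hz => ⟨Or.inl hz, hsub a ha hz⟩)).union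
      (hconn _ (h.map_mem b hb))
      ((hP.conn b (hSX hb)).nonempty.mono fun z hz => ⟨Or.inl (Or.inr hz), hsub b hb hz⟩)
    convert e using 1
    refine Set.Subset.antisymm (Set.union_subset_union_left _ Set.subset_union_right) ?_
    exact Set.union_subset (Set.union_subset (Set.union_subset_union (hsub a ha) (hsub b hb))
      Set.subset_union_left) Set.subset_union_right

/-- In a planar touching family, a clustering of `S` has many clusters if `S` has many more pairs
than elements. -/
theorem card_lt {K : ℕ} {P : V → Set ℂ} {X : Finset V} (h : IsClustering M S R f π d)
    (hS : S.Nonempty) (hP : TouchingFamily P X M) (hSX : S ⊆ X) (hM : IsLocallySparse K M)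
    (hK : ∀ c, 2 * (S.filter (f · = c)).card ≤ K) :
    (M ∩ S.sym2).card < S.card + 15 * R.card := by
  obtain ⟨v, hv⟩ := hS
  have h1 := (h.touchingFamily hP hSX).card_lt ⟨f v, h.map_mem v hv⟩
  rw [Finset.card_image_of_injOn (h.injOn_crossing hM hK)] at h1
  have h2 := h.card_le_card_crossing hM fun c => (Nat.le_mul_of_pos_left _ two_pos).trans (hK c)
  omega

end IsClustering

/-! ### Breadth-first decomposition and the non-planarity criterion. -/

section Decomposition

variable {V : Type*} [DecidableEq V] [Fintype V] {M : Finset (Sym2 V)}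

/-- A breadth-first search tree, cut at the levels of a suitable residue class modulo `r`, gives a
clustering into few clusters of small radius. -/
theorem exists_isClustering {S : Finset V} {root : V} (hroot : root ∈ S)
    (hreach : ∀ v ∈ S, v ∈ edgeBall (M ∩ S.sym2) S.card root) {r : ℕ} (hr : 0 < r) :
    ∃ R f π d, IsClustering M S R f π d ∧ (∀ v ∈ S, v ∈ edgeBall M r (f v)) ∧
      r * R.card ≤ S.card + r := by
  set N := M ∩ S.sym2 with hN
  set d : V → ℕ := fun v => sInf {k | v ∈ edgeBall N k root} with hd
  have hdmem : ∀ v ∈ S, v ∈ edgeBall N (d v) root := fun v hv =>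
    Nat.sInf_mem (s := {k | v ∈ edgeBall N k root}) ⟨_, hreach v hv⟩
  have hdle : ∀ v k, v ∈ edgeBall N k root → d v ≤ k := fun v k h => Nat.sInf_le h
  have hπ : ∀ v, ∃ y, v ∈ S → v ≠ root → y ∈ S ∧ s(v, y) ∈ M ∧ d y + 1 = d v := by
    intro v
    by_cases hv : v ∈ S ∧ v ≠ root
    · obtain ⟨hvS, hvr⟩ := hv
      have hm := hdmem v hvS
      rcases hk : d v with _ | k
      · rw [hk] at hm
        exact (hvr (by simpa [edgeBall] using hm)).elim
      · rw [hk] at hm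
        rcases mem_edgeBall_succ.mp hm with h | ⟨y, hy, hyv⟩
        · have := hdle v k h
          omega
        · have hy2 := edgeBall_subset hroot hy
          have h1 := hdle y k hy
          have h2 := hdle v (d y + 1) (mem_edgeBall_succ.mpr (Or.inr ⟨y, hdmem y hy2, hyv⟩))
          exact ⟨y, fun _ _ => ⟨hy2, Sym2.eq_swap ▸ (Finset.mem_inter.mp hyv).1, by omega⟩⟩
    · exact ⟨v, fun h1 h2 => (hv ⟨h1, h2⟩).elim⟩
  choose π hπ using hπ
  -- Pigeonhole over the residue classes of levels. The root is added to the chosen class, which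
  -- accounts for the extra `r` in the final bound.
  obtain ⟨j, hj, hjcard⟩ : ∃ j ∈ Finset.range r,
      r * (S.filter fun v => d v % r = j).card ≤ S.card := by
    by_contra! hcon
    have h1 := Finset.card_eq_sum_card_fiberwise (s := S) (t := Finset.range r)
      (f := fun v => d v % r) fun v _ => Finset.mem_coe.mpr (Finset.mem_range.mpr
        (Nat.mod_lt _ hr))
    have h2 := Finset.sum_lt_sum_of_nonempty (Finset.nonempty_range_iff.mpr hr.ne') hcon
    rw [← Finset.mul_sum, ← h1, Finset.sum_const, Finset.card_range, smul_eq_mul] at h2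
    exact lt_irrefl _ h2
  have hjr := Finset.mem_range.mp hj
  set R := insert root (S.filter fun v => d v % r = j) with hR
  have hRS : R ⊆ S := Finset.insert_subset hroot (Finset.filter_subset _ _)
  have hπ' : ∀ v ∈ S, v ∉ R → π v ∈ S ∧ s(v, π v) ∈ M ∧ d (π v) + 1 = d v := fun v hv hvR =>
    hπ v hv fun h => hvR (h ▸ Finset.mem_insert_self _ _)
  -- `g k v` climbs from `v` to the first vertex of `R`, with `k` bounding the number of steps; the
  -- depth `d v` is always enough.
  have hclimb : ∃ g : ℕ → V → V, (∀ v, g 0 v = v) ∧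
      ∀ k v, g (k + 1) v = if v ∈ R then v else g k (π v) :=
    ⟨fun k => Nat.rec id (fun _ g v => if v ∈ R then v else g (π v)) k,
      fun _ => rfl, fun _ _ => rfl⟩
  obtain ⟨g, g0, gs⟩ := hclimb
  set f : V → V := fun v => g (d v) v with hf
  have hfR : ∀ v ∈ R, f v = v := by
    intro v hv
    change g (d v) v = v
    rcases d v with _ | k
    · exact g0 v
    · rw [gs, if_pos hv]
  have hfπ : ∀ v ∈ S, v ∉ R → f (π v) = f v := by
    intro v hv hvR
    change g (d (π v)) (π v) = g (d v) v
    rw [← (hπ' v hv hvR).2.2, gs, if_neg hvR]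
  -- The radius `(d v + (r - j)) % r` is the height above the last cut level; it grows by one per
  -- level and returns to zero exactly on the levels in `R`.
  have hmain : ∀ k, ∀ v ∈ S, d v = k →
      f v ∈ R ∧ v ∈ edgeBall M ((d v + (r - j)) % r) (f v) := by
    intro k
    induction k with
    | zero =>
      intro v hv hk
      have hvR : v ∈ R := by
        by_contra hvR
        have := (hπ' v hv hvR).2.2
        omega
      rw [hfR v hvR]
      exact ⟨hvR, self_mem_edgeBall _ _ _⟩
    | succ k ih =>
      intro v hv hk
      by_cases hvR : v ∈ R
      · rw [hfR v hvR]
        exact ⟨hvR, self_mem_edgeBall _ _ _⟩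
      · obtain ⟨h1, h2, h3⟩ := hπ' v hv hvR
        obtain ⟨i1, i2⟩ := ih (π v) h1 (by omega)
        rw [hfπ v hv hvR] at i1 i2
        refine ⟨i1, ?_⟩
        have hmod : (d v + (r - j)) % r ≠ 0 := by
          intro h0
          refine hvR (Finset.mem_insert_of_mem (Finset.mem_filter.mpr ⟨hv, ?_⟩))
          have e1 : (d v + (r - j)) + j = d v + r := by omega
          have e2 : ((d v + (r - j)) + j) % r = j := by
            rw [Nat.add_mod, h0, zero_add, Nat.mod_mod, Nat.mod_eq_of_lt hjr]
          rwa [e1, Nat.add_mod_right] at e2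
        have hstep : (d v + (r - j)) % r = (d (π v) + (r - j)) % r + 1 := by
          have e3 : d v + (r - j) = d (π v) + (r - j) + 1 := by omega
          rw [e3] at hmod ⊢
          have e4 := Nat.mod_lt (d (π v) + (r - j)) hr
          rcases Nat.lt_or_ge ((d (π v) + (r - j)) % r + 1) r with hlt | hge
          · rw [← Nat.mod_add_mod, Nat.mod_eq_of_lt hlt]
          · exact (hmod (by
              rw [← Nat.mod_add_mod, show (d (π v) + (r - j)) % r + 1 = r by omega,
                Nat.mod_self])).elim
        rw [hstep]
        exact mem_edgeBall_succ.mpr (Or.inr ⟨π v, i2, Sym2.eq_swap ▸ h2⟩)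
  refine ⟨R, f, π, d, ⟨hRS, fun v hv => (hmain _ v hv rfl).1, hfR, fun v hv hvR =>
    (hπ' v hv hvR).1, fun v hv hvR => (hπ' v hv hvR).2.1, fun v hv hvR => (hπ' v hv hvR).2.2,
    hfπ⟩, fun v hv => edgeBall_mono (Nat.mod_lt _ hr).le (hmain _ v hv rfl).2, ?_⟩
  have := Nat.mul_le_mul_left r (Finset.card_insert_le root (S.filter fun v => d v % r = j))
  rw [← hR, mul_add, mul_one] at this
  omega

/-- A vertex set which is minimal among those spanning at least `a` times as many edges as it has
vertices is connected. -/
theorem exists_connected_dense [Nonempty V] {a : ℝ} (h : a * Fintype.card V ≤ M.card) :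
    ∃ S : Finset V, a * S.card ≤ (M ∩ S.sym2).card ∧
      ∃ root ∈ S, ∀ v ∈ S, v ∈ edgeBall (M ∩ S.sym2) S.card root := by
  obtain ⟨S, hS, hmin⟩ := Finset.exists_min_image
    (Finset.univ.filter fun S : Finset V => S.Nonempty ∧ a * S.card ≤ (M ∩ S.sym2).card)
    Finset.card ⟨Finset.univ, by simpa using h⟩
  simp only [Finset.mem_filter, Finset.mem_univ, true_and] at hS hmin
  obtain ⟨⟨root, hroot⟩, hS⟩ := hS
  refine ⟨S, hS, root, hroot, ?_⟩
  set A := edgeBall (M ∩ S.sym2) S.card root with hA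
  have hAS : A ⊆ S := edgeBall_subset hroot
  have hrA : root ∈ A := self_mem_edgeBall _ _ _
  by_contra! hne
  obtain ⟨v, hv, hvA⟩ := hne
  have hsub := inter_sym2_subset_union (M := M) (X := S) (A := A) fun u hu w hw huw =>
    mem_edgeBall_of_mem hroot le_rfl hu
      (Finset.mem_inter.mpr ⟨huw, Finset.mk_mem_sym2_iff.mpr ⟨hAS hu, hw⟩⟩)
  have h1 := (Finset.card_le_card hsub).trans (Finset.card_union_le _ _)
  have hcard := Finset.card_sdiff_add_card_eq_card hAS
  have hApos := Finset.card_pos.mpr ⟨root, hrA⟩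
  have hBpos := Finset.card_pos.mpr ⟨v, Finset.mem_sdiff.mpr ⟨hv, hvA⟩⟩
  -- Were `S` disconnected, both parts would be smaller and hence below density `a`, and so would
  -- their union.
  have h2 : ((M ∩ A.sym2).card : ℝ) < a * A.card := by
    by_contra! hle
    have := hmin A ⟨⟨root, hrA⟩, hle⟩
    omega
  have h3 : ((M ∩ (S \ A).sym2).card : ℝ) < a * (S \ A).card := by
    by_contra! hle
    have := hmin (S \ A) ⟨⟨v, Finset.mem_sdiff.mpr ⟨hv, hvA⟩⟩, hle⟩
    omega
  have h4 : ((M ∩ S.sym2).card : ℝ) ≤ (M ∩ A.sym2).card + (M ∩ (S \ A).sym2).card := by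
    exact_mod_cast h1
  have h5 : (S.card : ℝ) = (S \ A).card + A.card := by exact_mod_cast hcard.symm
  rw [h5] at hS
  linarith

/-- A locally sparse graph of bounded degree with at least `(1 + ε) n` edges is not the touching
graph of a family in the plane. -/
theorem TouchingFamily.false_of_isLocallySparse [Nonempty V] {P : V → Set ℂ}
    (hP : TouchingFamily P Finset.univ M) {ε : ℝ} (hε : 0 < ε) {r Δ K : ℕ} (hr : 30 ≤ ε * r)
    (hΔ : ∀ v, (Finset.univ.filter fun w => s(v, w) ∈ M).card ≤ Δ)
    (hK : 2 * (Δ + 1) ^ r ≤ K) (hrK : r ≤ K) (hM : IsLocallySparse K M)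
    (hcard : (1 + ε) * Fintype.card V ≤ M.card) : False := by
  obtain ⟨S, hS, root, hroot, hreach⟩ := exists_connected_dense hcard
  have hr0 : 0 < r := by
    rcases Nat.eq_zero_or_pos r with rfl | h
    · norm_num at hr
    · exact h
  have hSpos : 0 < S.card := Finset.card_pos.mpr ⟨root, hroot⟩
  obtain ⟨R, f, π, d, h, hball, hR⟩ := exists_isClustering hroot hreach hr0
  have hlt := h.card_lt (K := K) ⟨root, hroot⟩ hP (Finset.subset_univ S) hM fun c => by
    refine le_trans (Nat.mul_le_mul_left 2 (le_trans (Finset.card_le_card fun v hv => ?_)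
      (card_edgeBall_le hΔ r c))) hK
    obtain ⟨hvS, rfl⟩ := Finset.mem_filter.mp hv
    exact hball v hvS
  -- A smaller `S` would have at most `K` vertices and so be sparse. Consequently `r |R| ≤ |S| + r ≤
  -- 2 |S|`, and `15 |R| ≤ 30 |S| / r ≤ ε |S|`.
  have hrS : r ≤ S.card := by
    by_contra! hlt'
    have h1 := hM S ⟨root, hroot⟩ (by omega)
    have h2 : ((M ∩ S.sym2).card : ℝ) < S.card := by exact_mod_cast h1
    have h3 : (0 : ℝ) < S.card := by exact_mod_cast hSpos
    nlinarith
  have h1 : ((M ∩ S.sym2).card : ℝ) < S.card + 15 * R.card := by exact_mod_cast hlt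
  have h2 : (r : ℝ) * R.card ≤ 2 * S.card := by
    have : r * R.card ≤ 2 * S.card := by omega
    exact_mod_cast this
  have h3 : (0 : ℝ) < S.card := by exact_mod_cast hSpos
  have h4 : (0 : ℝ) < r := by exact_mod_cast hr0
  have h5 : ε * S.card < 15 * R.card := by linarith
  have h6 : r * (ε * S.card) < r * (15 * R.card) := mul_lt_mul_of_pos_left h5 h4
  nlinarith

end Decomposition

/-! ### From plane drawings to touching families. -/

theorem TouchingFamily.image {V E F : Type*} [TopologicalSpace E] [TopologicalSpace F]
    {P : V → Set E} {X : Finset V} {M : Finset (Sym2 V)} (h : TouchingFamily P X M) {φ : E → F}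
    (hφ : Continuous φ) (hinj : Function.Injective φ) : TouchingFamily (fun v => φ '' P v) X M where
  conn v hv := (h.conn v hv).image hφ
  disj u hu v hv huv := (Set.disjoint_image_iff hinj).mpr (h.disj u hu v hv huv)
  ne := h.ne
  mem := h.mem
  edge u v huv := by
    rw [← Set.image_union]
    exact (h.edge u v huv).image hφ

namespace PlaneDrawing

variable {V : Type*} {G : SimpleGraph V} (D : PlaneDrawing G)

/-- The point of `v` together with the arcs starting at `v` without their last points. -/
def star (v : V) : Set (EuclideanSpace ℝ (Fin 2)) :=
  {x | x = D.point v ∨ ∃ e, D.arc e 0 = D.point v ∧ ∃ t ∈ Set.Ioo (0 : unitInterval) 1,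
    D.arc e t = x}

theorem isPathConnected_star (v : V) : IsPathConnected (D.star v) := by
  refine ⟨D.point v, Or.inl rfl, fun {x} hx => ?_⟩
  rcases hx with rfl | ⟨e, he, t, ht, rfl⟩
  · exact JoinedIn.refl (Or.inl rfl)
  · refine ⟨⟨⟨fun s => D.arc e (s * t), by fun_prop⟩, by simp [he], by simp⟩, fun s => ?_⟩
    change D.arc e (s * t) ∈ D.star v
    rcases eq_or_lt_of_le (unitInterval.nonneg' (t := s * t)) with h0 | h0
    · rw [← h0, he]
      exact Or.inl rfl
    · exact Or.inr ⟨e, he, s * t, ⟨h0, lt_of_le_of_lt unitInterval.mul_le_right ht.2⟩, rfl⟩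

theorem disjoint_star {u v : V} (huv : u ≠ v) : Disjoint (D.star u) (D.star v) := by
  refine Set.disjoint_left.mpr fun x hu hv => ?_
  rcases hu with rfl | ⟨e, he, s, hs, rfl⟩ <;> rcases hv with h | ⟨f, hf, t, ht, h⟩
  · exact huv (D.point_injective h)
  · exact D.arc_ne_point f t ht u h
  · exact D.arc_ne_point e s hs v h
  · by_cases hef : e = f
    · subst hef
      exact huv (D.point_injective (he.symm.trans hf))
    · exact D.arc_ne_arc e f hef s hs t ht h.symm

/-- The whole arc lies in the union: its last point is the point of `v`, and everything before
belongs to the star of `u`. -/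
theorem isPathConnected_star_union_of_arc {u v : V} {e : G.edgeSet} (h0 : D.arc e 0 = D.point u)
    (h1 : D.arc e 1 = D.point v) : IsPathConnected (D.star u ∪ D.star v) := by
  have : PathConnectedSpace unitInterval := isPathConnected_iff_pathConnectedSpace.mp
    ((convex_Icc 0 1).isPathConnected ⟨0, by simp⟩)
  have hr : IsPathConnected (Set.range (D.arc e)) := isPathConnected_range (D.arc e).continuous
  have hsub : Set.range (D.arc e) ⊆ D.star u ∪ D.star v := by
    rintro _ ⟨t, rfl⟩
    rcases eq_or_lt_of_le (unitInterval.nonneg' (t := t)) with ht0 | ht0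
    · exact Or.inl (Or.inl (by rw [← ht0, h0]))
    · rcases eq_or_lt_of_le (unitInterval.le_one' (t := t)) with ht1 | ht1
      · exact Or.inr (Or.inl (by rw [ht1, h1]))
      · exact Or.inl (Or.inr ⟨e, h0, t, ⟨ht0, ht1⟩, rfl⟩)
  have key := ((D.isPathConnected_star u).union hr ⟨D.point u, Or.inl rfl, 0, h0⟩).union
    (D.isPathConnected_star v) ⟨D.point v, Or.inr ⟨1, h1⟩, Or.inl rfl⟩
  convert key using 1
  refine Set.Subset.antisymm (Set.union_subset_union_left _ Set.subset_union_left) ?_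
  exact Set.union_subset (Set.union_subset Set.subset_union_left hsub) Set.subset_union_right

theorem isPathConnected_star_union {u v : V} (huv : G.Adj u v) :
    IsPathConnected (D.star u ∪ D.star v) := by
  have h := D.arc_ends ⟨s(u, v), huv⟩
  rw [Sym2.map_mk] at h
  rcases Sym2.eq_iff.mp h with ⟨h0, h1⟩ | ⟨h0, h1⟩
  · exact D.isPathConnected_star_union_of_arc h0 h1
  · rw [Set.union_comm]
    exact D.isPathConnected_star_union_of_arc h0 h1

end PlaneDrawing

/-- A planar graph is the touching graph of a family in the plane. -/
theorem IsPlanar.exists_touchingFamily {V : Type*} [Fintype V] {M : Finset (Sym2 V)}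
    (hM : ∀ e ∈ M, ¬ e.IsDiag) (h : IsPlanar (SimpleGraph.fromEdgeSet (M : Set (Sym2 V)))) :
    ∃ P : V → Set ℂ, TouchingFamily P Finset.univ M := by
  obtain ⟨D⟩ := h
  have hD : TouchingFamily D.star Finset.univ M :=
    { conn := fun v _ => D.isPathConnected_star v
      disj := fun u _ v _ huv => D.disjoint_star huv
      ne := fun u v huv => by simpa using hM _ huv
      mem := fun u v _ => Finset.mem_univ u
      edge := fun u v huv => D.isPathConnected_star_union (by
        simpa using ⟨huv, by simpa using hM _ huv⟩) }
  exact ⟨_, hD.image (φ := Complex.orthonormalBasisOneI.repr.symm)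
    (LinearIsometryEquiv.continuous _) (LinearIsometryEquiv.injective _)⟩

/-- A locally sparse graph of bounded degree with at least `(1 + ε) n` edges is not planar. -/
theorem not_isPlanar_of_isLocallySparse {V : Type*} [DecidableEq V] [Fintype V] [Nonempty V]
    {M : Finset (Sym2 V)} (hdiag : ∀ e ∈ M, ¬ e.IsDiag) {ε : ℝ} (hε : 0 < ε) {r Δ K : ℕ}
    (hr : 30 ≤ ε * r) (hΔ : ∀ v, (Finset.univ.filter fun w => s(v, w) ∈ M).card ≤ Δ)
    (hK : 2 * (Δ + 1) ^ r ≤ K) (hrK : r ≤ K) (hM : IsLocallySparse K M)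
    (hcard : (1 + ε) * Fintype.card V ≤ M.card) :
    ¬ IsPlanar (SimpleGraph.fromEdgeSet (M : Set (Sym2 V))) := by
  intro h
  obtain ⟨P, hP⟩ := h.exists_touchingFamily hdiag
  exact hP.false_of_isLocallySparse hε hr hΔ hK hrK hM hcard

/-! ### Maker's strategy from an invariant. -/

section Game

variable {α : Type*} [DecidableEq α] {board : Finset α} {H : Set (Finset α)} {b : ℕ}

theorem isLegalClaim_singleton {M B : Finset α} {x : α} (hx : x ∈ board \ (M ∪ B)) :
    IsLegalClaim board 1 M B {x} := by
  refine ⟨Finset.singleton_subset_iff.mpr hx, ?_⟩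
  have := Finset.card_pos.mpr ⟨x, hx⟩
  rw [Finset.card_singleton]
  omega

/-- Maker wins from every position in which he has occupied a winning set. -/
theorem MakerWinsFrom.of_subset {M B A : Finset α} (hA : A ∈ H) (hAM : A ⊆ M) :
    MakerWinsFrom board H 1 b M B := by
  induction hk : (board \ (M ∪ B)).card using Nat.strong_induction_on generalizing M B with
  | _ k ih =>
  rcases (board \ (M ∪ B)).eq_empty_or_nonempty with h0 | hne
  · exact .final M B h0 ⟨A, hA, hAM⟩
  · obtain ⟨x, hx⟩ := hne
    refine .turn M B {x} ⟨x, hx⟩ (isLegalClaim_singleton hx) fun D hD => ?_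
    refine ih _ ?_ (hAM.trans Finset.subset_union_left) rfl
    rw [← hk]
    refine Finset.card_lt_card (Finset.ssubset_iff_of_subset ?_ |>.mpr ⟨x, hx, by simp⟩)
    exact Finset.sdiff_subset_sdiff subset_rfl
      (Finset.union_subset_union Finset.subset_union_left Finset.subset_union_left)

/-- Maker wins if, until he has `T` elements, he can always claim a free element without violating
`I`, and if every set of `T` elements with the property `I` contains a winning set. -/
theorem MakerWinsFrom.of_invariant {I : Finset α → Prop} {T : ℕ}
    (hwin : ∀ M, I M → M.card = T → ∃ A ∈ H, A ⊆ M)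
    (hstep : ∀ M B, I M → M.card < T → B.card ≤ b * M.card →
      ∃ x ∈ board \ (M ∪ B), I (insert x M)) {M B : Finset α} (hM : I M) (hT : M.card ≤ T)
    (hB : B.card ≤ b * M.card) : MakerWinsFrom board H 1 b M B := by
  induction hk : T - M.card generalizing M B with
  | zero =>
    obtain ⟨A, hA, hAM⟩ := hwin M hM (by omega)
    exact .of_subset hA hAM
  | succ k ih =>
    obtain ⟨x, hx, hI⟩ := hstep M B hM (by omega) hB
    have hxM : x ∉ M := fun h => (Finset.mem_sdiff.mp hx).2 (Finset.mem_union_left _ h)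
    have hins : M ∪ {x} = insert x M := by rw [Finset.union_comm, Finset.insert_eq]
    have hcard := Finset.card_insert_of_notMem hxM
    refine .turn M B {x} ⟨x, hx⟩ (isLegalClaim_singleton hx) fun D hD => ?_
    rw [hins] at hD ⊢
    refine ih hI (by omega) ?_ (by omega)
    have h1 := Finset.card_union_le B D
    have h2 : D.card ≤ b := hD.2 ▸ min_le_left _ _
    rw [hcard, mul_add, mul_one]
    omega

end Game

/-! ### Finding a free edge that preserves the invariant. -/

section FreeEdge

variable {V : Type*} [DecidableEq V] [Fintype V] {M : Finset (Sym2 V)}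

theorem card_neighbors_insert_le {Δ : ℕ} {x y : V}
    (hΔ : ∀ v, (Finset.univ.filter fun w => s(v, w) ∈ M).card ≤ Δ)
    (hx : (Finset.univ.filter fun w => s(x, w) ∈ M).card < Δ)
    (hy : (Finset.univ.filter fun w => s(y, w) ∈ M).card < Δ) (v : V) :
    (Finset.univ.filter fun w => s(v, w) ∈ insert s(x, y) M).card ≤ Δ := by
  have key : ∀ u z : V, s(u, z) = s(x, y) →
      (Finset.univ.filter fun w => s(u, w) ∈ M).card < Δ →
      (Finset.univ.filter fun w => s(u, w) ∈ insert s(x, y) M).card ≤ Δ := by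
    intro u z huz hu
    have hsub : (Finset.univ.filter fun w => s(u, w) ∈ insert s(x, y) M) ⊆
        insert z (Finset.univ.filter fun w => s(u, w) ∈ M) := by
      intro w hw
      simp only [Finset.mem_filter, Finset.mem_univ, true_and, Finset.mem_insert, ← huz,
        Sym2.congr_right] at hw ⊢
      exact hw
    have h1 := (Finset.card_le_card hsub).trans (Finset.card_insert_le _ _)
    omega
  by_cases hvx : v = x
  · subst hvx
    exact key v y rfl hx
  · by_cases hvy : v = y
    · subst hvy
      exact key v x Sym2.eq_swap hy
    · refine le_trans (Finset.card_le_card fun w hw => ?_) (hΔ v)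
      simp only [Finset.mem_filter, Finset.mem_univ, true_and, Finset.mem_insert] at hw ⊢
      refine hw.resolve_left fun h => ?_
      rcases Sym2.eq_iff.mp h with ⟨h, -⟩ | ⟨h, -⟩
      exacts [hvx h, hvy h]

theorem card_mul_le_two_mul_card {Δ : ℕ} :
    (Finset.univ.filter fun v => Δ ≤ (Finset.univ.filter fun w => s(v, w) ∈ M).card).card * Δ ≤
      2 * M.card := by
  set A := (Finset.univ : Finset (V × V)).filter fun p => s(p.1, p.2) ∈ M with hA
  have h1 : (Finset.univ.filter fun v =>
      Δ ≤ (Finset.univ.filter fun w => s(v, w) ∈ M).card).card * Δ ≤ A.card := by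
    rw [hA, Finset.card_filter _ (Finset.univ : Finset (V × V)), ← Finset.univ_product_univ,
      Finset.sum_product, ← smul_eq_mul]
    refine (Finset.card_nsmul_le_sum _ (fun v => ∑ w, if s(v, w) ∈ M then 1 else 0) _
      fun v hv => ?_).trans (Finset.sum_le_univ_sum_of_nonneg fun _ => Nat.zero_le _)
    rw [← Finset.card_filter]
    exact (Finset.mem_filter.mp hv).2
  have h2 := card_le_two_mul_card_image_mk A
  have h3 : (A.image fun p => s(p.1, p.2)) ⊆ M := by
    intro e he
    obtain ⟨p, hp, rfl⟩ := Finset.mem_image.mp he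
    exact (Finset.mem_filter.mp hp).2
  have h4 := Finset.card_le_card h3
  omega

/-- Among sufficiently many pairs there is one whose insertion keeps the degrees bounded by `Δ` and
the graph locally sparse. -/
theorem exists_insert_isLocallySparse {Δ K h : ℕ} {F : Finset (Sym2 V)}
    (hΔ : ∀ v, (Finset.univ.filter fun w => s(v, w) ∈ M).card ≤ Δ) (hM : IsLocallySparse K M)
    (hh : (Finset.univ.filter fun v =>
      Δ ≤ (Finset.univ.filter fun w => s(v, w) ∈ M).card).card = h)
    (hF : h * Fintype.card V + Fintype.card V * (Δ + 1) ^ K < F.card) :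
    ∃ e ∈ F, (∀ v, (Finset.univ.filter fun w => s(v, w) ∈ insert e M).card ≤ Δ) ∧
      IsLocallySparse K (insert e M) := by
  set L := Finset.univ.filter fun v =>
    Δ ≤ (Finset.univ.filter fun w => s(v, w) ∈ M).card with hL
  set A : Finset (V × V) := (L ×ˢ Finset.univ) ∪
    Finset.univ.filter fun p => p.2 ∈ edgeBall M K p.1 with hA
  have hball : ((Finset.univ : Finset (V × V)).filter fun p => p.2 ∈ edgeBall M K p.1).card ≤
      Fintype.card V * (Δ + 1) ^ K := by
    rw [Finset.card_filter, ← Finset.univ_product_univ, Finset.sum_product, ← smul_eq_mul]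
    refine Finset.sum_le_card_nsmul _ _ _ fun v _ => ?_
    rw [← Finset.card_filter]
    exact (Finset.card_le_card fun w hw => (Finset.mem_filter.mp hw).2).trans
      (card_edgeBall_le hΔ K v)
  have hAcard : (A.image fun p => s(p.1, p.2)).card < F.card := by
    refine lt_of_le_of_lt (Finset.card_image_le.trans ((Finset.card_union_le _ _).trans
      (add_le_add ?_ hball))) hF
    rw [Finset.card_product, hh, Finset.card_univ]
  obtain ⟨e, heF, heA⟩ := Finset.exists_mem_notMem_of_card_lt_card hAcard
  refine ⟨e, heF, ?_⟩
  induction e using Sym2.ind with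
  | _ x y =>
    -- Both orders are needed: each one bounds the degree of one endpoint.
    have h1 : (x, y) ∉ A := fun h => heA (Finset.mem_image.mpr ⟨_, h, rfl⟩)
    have h2 : (y, x) ∉ A := fun h => heA (Finset.mem_image.mpr ⟨_, h, Sym2.eq_swap⟩)
    simp only [hA, hL, Finset.mem_union, Finset.mem_product, Finset.mem_filter, Finset.mem_univ,
      true_and, and_true, not_or, not_le] at h1 h2
    exact ⟨card_neighbors_insert_le hΔ h1.1 h2.1, hM.insert h1.2⟩

end FreeEdge

/-- Breaker's share is at most `(1/2 - ε/2 - ε²) n²`, and `16 h ≤ ε Δ h ≤ 2 ε m ≤ 4 ε n` gives `h n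
≤ ε n² / 4`. The linear terms, including the `n / 2` missing from `n² / 2`, stay below `(C + 3) n ≤
ε n² / 4`. -/
theorem claimed_add_forbidden_lt {ε n b m h Δ C : ℝ} (hε : 0 < ε) (hε' : ε ≤ 1 / 2) (hn : 0 < n)
    (hm0 : 0 ≤ m) (hh0 : 0 ≤ h)
    (hb : b ≤ (1 / 2 - ε) * n) (hm : m ≤ (1 + ε) * n) (hh : h * Δ ≤ 2 * m) (hΔ : 16 ≤ ε * Δ)
    (hC : 4 * (C + 3) ≤ ε * n) : m + b * m + (h * n + n * C) < n * (n - 1) / 2 := by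
  have h1 : b * m ≤ (1 / 2 - ε) * n * ((1 + ε) * n) :=
    (mul_le_mul_of_nonneg_right hb hm0).trans
      (mul_le_mul_of_nonneg_left hm (mul_nonneg (by linarith) hn.le))
  have h2 : 16 * h ≤ 4 * (ε * n) := by
    have e1 : h * 16 ≤ h * (ε * Δ) := mul_le_mul_of_nonneg_left hΔ hh0
    have e2 : ε * (h * Δ) ≤ ε * (2 * ((1 + ε) * n)) :=
      mul_le_mul_of_nonneg_left (by linarith) hε.le
    have e3 : ε * n * ε ≤ ε * n * 1 := mul_le_mul_of_nonneg_left (by linarith) (by positivity)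
    nlinarith
  have h3 : h * n ≤ ε * n / 4 * n := mul_le_mul_of_nonneg_right (by linarith) hn.le
  have h4 : 4 * (C + 3) * n ≤ ε * n * n := mul_le_mul_of_nonneg_right hC hn.le
  have h5 : 0 ≤ ε * n * (ε * n) := by positivity
  have h6 : ε * n ≤ 1 / 2 * n := mul_le_mul_of_nonneg_right hε' hn.le
  nlinarith

theorem mainTheorem8 (ε : ℝ) (hε : 0 < ε) :
    ∃ N : ℕ, ∀ n : ℕ, N ≤ n → ∀ b : ℕ, 0 < b → (b : ℝ) ≤ (1 / 2 - ε) * n →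
      MakerWins (completeBoard n) (nonPlanarSets n) 1 b := by
  obtain ⟨r, hr⟩ := exists_nat_ge (30 / ε)
  obtain ⟨Δ, hΔ⟩ := exists_nat_ge (16 / ε)
  rw [div_le_iff₀' hε] at hr hΔ
  -- `K` bounds the size of two clusters of radius `r` together, and is at least `r`.
  set K := 2 * (Δ + 1) ^ r + r with hK
  obtain ⟨N, hN⟩ := exists_nat_ge (4 * (((Δ : ℝ) + 1) ^ K + 3) / ε)
  rw [div_le_iff₀' hε] at hN
  refine ⟨N, fun n hNn b hb0 hb => ?_⟩
  have hb0' : (0 : ℝ) < b := by exact_mod_cast hb0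
  have hn : (0 : ℝ) < n := by
    refine lt_of_le_of_ne n.cast_nonneg fun h => ?_
    rw [← h, mul_zero] at hb
    linarith
  -- For larger `ε` the bound on the positive bias `b` would be negative.
  have hε' : ε ≤ 1 / 2 := by
    by_contra! h
    nlinarith
  have hn' : 0 < n := by exact_mod_cast hn
  have : Nonempty (Fin n) := ⟨⟨0, hn'⟩⟩
  have hboard : ∀ e ∈ completeBoard n, ¬ e.IsDiag := fun e he =>
    SimpleGraph.not_isDiag_of_mem_edgeFinset he
  have hcardboard : ((completeBoard n).card : ℝ) = n * (n - 1) / 2 := by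
    rw [completeBoard, SimpleGraph.card_edgeFinset_top_eq_card_choose_two, Fintype.card_fin,
      Nat.cast_choose_two]
  refine MakerWinsFrom.of_invariant (T := ⌈(1 + ε) * n⌉₊)
    (I := fun M => M ⊆ completeBoard n ∧
      (∀ v, (Finset.univ.filter fun w => s(v, w) ∈ M).card ≤ Δ) ∧ IsLocallySparse K M)
    ?_ ?_ ⟨Finset.empty_subset _, by simp, fun X hX _ => by simpa using hX⟩ (by simp) (by simp)
  · rintro M ⟨hMb, hMΔ, hMK⟩ hcard
    refine ⟨M, ⟨hMb, ?_⟩, subset_rfl⟩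
    refine not_isPlanar_of_isLocallySparse (fun e he => hboard e (hMb he)) hε hr hMΔ
      (Nat.le_add_right _ _) (Nat.le_add_left _ _) hMK ?_
    rw [hcard, Fintype.card_fin]
    exact Nat.le_ceil _
  · rintro M B ⟨hMb, hMΔ, hMK⟩ hcard hB
    set h := (Finset.univ.filter fun v =>
      Δ ≤ (Finset.univ.filter fun w => s(v, w) ∈ M).card).card with hh
    have hdeg : h * Δ ≤ 2 * M.card := card_mul_le_two_mul_card
    have hlt := claimed_add_forbidden_lt (C := ((Δ : ℝ) + 1) ^ K) (m := M.card) (h := h) (Δ := Δ)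
      hε hε' hn (Nat.cast_nonneg _) (Nat.cast_nonneg _) hb (Nat.lt_ceil.mp hcard).le
      (by exact_mod_cast hdeg) hΔ
      (hN.trans (mul_le_mul_of_nonneg_left (by exact_mod_cast hNn) hε.le))
    rw [← hcardboard] at hlt
    have hlt' : M.card + b * M.card + (h * n + n * (Δ + 1) ^ K) < (completeBoard n).card := by
      exact_mod_cast hlt
    have h1 := Finset.le_card_sdiff (M ∪ B) (completeBoard n)
    have h2 := Finset.card_union_le M B
    obtain ⟨e, he, he1, he2⟩ := exists_insert_isLocallySparse
      (F := completeBoard n \ (M ∪ B)) hMΔ hMK hh.symm (by rw [Fintype.card_fin]; omega)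
    exact ⟨e, he, Finset.insert_subset (Finset.mem_sdiff.mp he).1 hMb, he1, he2⟩
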